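/- Let $n\ge 3$. For a field $F$, let $T_n(F)$ be the group of invertible upper triangular $n\times n$ matrices over $F$, let $UT_n(F)$ be its subgroup of matrices with all diagonal entries $1$, and embed $B_n(F)=(F^\times)^{n-1}$ in $T_n(F)$ by $(a_1,\dots,a_{n-1})\mapsto \mathrm{diag}(a_1,\dots,a_{n-1},1)$. For abelian groups $B,A$, let $S^2(B,A)$ be the set of symmetric 2-cocycles, that is, of maps $f:B\times B\to A$ with $f(xy,z)f(x,y)=f(x,yz)f(y,z)$, $f(1,x)=f(x,1)=1$ and $f(x,y)=f(y,x)$ for all $x,y,z\in B$. For $f\in S^2(B_n(F),F^\times)$, let $D_n(F,f)$ be the abelian group with underlying set $B_n(F)\times F^\times$ and multiplication $(b_1,z_1)(b_2,z_2)=(b_1b_2,\,z_1z_2f(b_1,b_2))$, and let $T_n(F,f)=UT_n(F)\rtimes D_n(F,f)$ (an abelian deformation of $T_n(F)$), where $(b,z)$ acts on $UT_n(F)$ by $u\mapsto bub^{-1}$. Write $\equiv$ for elementary equivalence (of fields in the language of rings, of groups in the language of groups). Then there exist a field $F\equiv\mathbb Q$ and a symmetric 2-cocycle $f\in S^2((F^\times)^{n-1},F^\times)$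 such that $T_n(F,f)\equiv T_n(\mathbb Q)$, but $T_n(F,f)$ is not isomorphic, as a group, to $T_n(L)$ for any field $L$. -/

import Mathlib

namespace TriangularDeformation

open scoped FirstOrder

/-! ### First-order languages and elementary equivalence -/

/-- The operation symbols of the language of groups: multiplication, inverse, identity. -/
inductive GroupFunc : ℕ → Type
  | mul : GroupFunc 2
  | inv : GroupFunc 1
  | one : GroupFunc 0

/-- The first-order language of groups. -/
def groupLanguage : FirstOrder.Language.{0, 0} where
  Functions := GroupFunc
  Relations := fun _ => Empty

/-- Every group is a structure for the language of groups. -/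
instance groupStructure (G : Type*) [Group G] : groupLanguage.Structure G where
  funMap := fun {k} s =>
    match k, s with
    | _, GroupFunc.mul => fun x => x 0 * x 1
    | _, GroupFunc.inv => fun x => (x 0)⁻¹
    | _, GroupFunc.one => fun _ => 1
  RelMap := fun {_} r => r.elim

/-- Elementary equivalence of groups. -/
def GroupElemEquiv (G H : Type*) [Group G] [Group H] : Prop :=
  G ≅[groupLanguage] H

/-- Elementary equivalence of fields, in the language of rings. -/
def FieldElemEquiv (K L : Type*) [Field K] [Field L] : Prop :=
  letI := FirstOrder.Ring.compatibleRingOfRing K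
  letI := FirstOrder.Ring.compatibleRingOfRing L
  K ≅[FirstOrder.Language.ring] L

/-! ### Triangular groups -/

section Triangular

variable (n : ℕ) (R : Type*) [CommRing R]

/-- `T_n(R)`: the group of invertible upper triangular `n × n` matrices. -/
def T : Subgroup (GL (Fin n) R) where
  carrier := {g | (g : Matrix (Fin n) (Fin n) R).IsUpperTriangular}
  mul_mem' := fun {a b} ha hb => by
    simpa using Matrix.BlockTriangular.mul ha hb
  one_mem' := by
    simpa using Matrix.blockTriangular_one
  inv_mem' := fun {a} ha => by
    have : Invertible (a : Matrix (Fin n) (Fin n) R) := a.invertible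
    simpa using Matrix.blockTriangular_inv_of_blockTriangular ha

variable {n R}

theorem T.mul_diag (g h : T n R) (i : Fin n) :
    ((g * h : T n R) : GL (Fin n) R) i i
      = (g : GL (Fin n) R) i i * (h : GL (Fin n) R) i i := by
  have hg : ∀ a b : Fin n, b < a → (g : GL (Fin n) R) a b = 0 := fun a b hab => g.2 hab
  have hh : ∀ a b : Fin n, b < a → (h : GL (Fin n) R) a b = 0 := fun a b hab => h.2 hab
  simp only [Subgroup.coe_mul, Units.val_mul, Matrix.mul_apply]
  refine Finset.sum_eq_single i (fun j _ hj => ?_) (fun hi => absurd (Finset.mem_univ i) hi)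
  rcases lt_or_gt_of_ne hj with hlt | hgt
  · simp [hg i j hlt]
  · simp [hh j i hgt]

theorem T.inv_diag (g : T n R) (i : Fin n) :
    (g : GL (Fin n) R) i i * ((g⁻¹ : T n R) : GL (Fin n) R) i i = 1 := by
  rw [← T.mul_diag, mul_inv_cancel]
  simp

variable (n R)

/-- `UT_n(R)`: the subgroup of `T_n(R)` of matrices with all diagonal entries equal to `1`. -/
def UT : Subgroup (T n R) where
  carrier := {g | ∀ i, (g : GL (Fin n) R) i i = 1}
  mul_mem' := fun {a b} ha hb i => by rw [T.mul_diag, ha i, hb i, one_mul]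
  one_mem' := fun i => by simp
  inv_mem' := fun {a} ha i => by
    have h := T.inv_diag a i
    rwa [ha i, one_mul] at h

instance UT.normal : (UT n R).Normal where
  conj_mem u hu g i := by
    rw [T.mul_diag, T.mul_diag, hu i, mul_one, T.inv_diag]

/-- The diagonal matrix `diag(a_1, …, a_n)`, as an element of `T_n(R)`. -/
def diagHom : (Fin n → Rˣ) →* T n R where
  toFun a :=
    ⟨⟨Matrix.diagonal fun i => (a i : R), Matrix.diagonal fun i => ((a i)⁻¹ : Rˣ),
      by simp [Matrix.diagonal_mul_diagonal], by simp [Matrix.diagonal_mul_diagonal]⟩,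
      Matrix.blockTriangular_diagonal _⟩
  map_one' := by
    apply Subtype.ext
    apply Units.ext
    exact Matrix.diagonal_one
  map_mul' a b := by
    apply Subtype.ext
    apply Units.ext
    exact (Matrix.diagonal_mul_diagonal _ _).symm

/-- `B_n(R) = d_1(Rˣ) ⋯ d_{n-1}(Rˣ)`, presented as `(Rˣ)^{n-1}`. -/
abbrev B : Type _ := Fin (n - 1) → Rˣ

/-- The embedding of `B_n(R)` in the diagonal matrices:
`(a_1, …, a_{n-1}) ↦ d_1(a_1) ⋯ d_{n-1}(a_{n-1}) = diag(a_1, …, a_{n-1}, 1)`. -/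
def BHom : B n R →* T n R :=
  (diagHom n R).comp
    { toFun := fun a i => if h : (i : ℕ) < n - 1 then a ⟨i, h⟩ else 1
      map_one' := by
        funext i
        simp
      map_mul' := fun a b => by
        funext i
        by_cases h : (i : ℕ) < n - 1 <;> simp [h] }

end Triangular

/-! ### Symmetric 2-cocycles and abelian deformations -/

/-- `S²(B, A)`: the normalized symmetric 2-cocycles on `B` with values in `A`
(trivial action). -/
structure SymCocycle (B A : Type*) [CommGroup B] [CommGroup A] where
  toFun : B → B → A
  cocycle : ∀ x y z, toFun (x * y) z * toFun x y = toFun x (y * z) * toFun y z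
  one_left : ∀ x, toFun 1 x = 1
  one_right : ∀ x, toFun x 1 = 1
  symm : ∀ x y, toFun x y = toFun y x

/-- The abelian extension `E(f)` of `A` by `B` defined by the symmetric 2-cocycle `f`:
pairs `(b, a)` multiplied by `(b₁, a₁)(b₂, a₂) = (b₁b₂, a₁a₂f(b₁, b₂))`. -/
@[ext]
structure CocycleExt {B A : Type*} [CommGroup B] [CommGroup A] (f : SymCocycle B A) where
  base : B
  fiber : A

namespace CocycleExt

variable {B A : Type*} [CommGroup B] [CommGroup A] (f : SymCocycle B A)

instance : Mul (CocycleExt f) :=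
  ⟨fun x y => ⟨x.base * y.base, x.fiber * y.fiber * f.toFun x.base y.base⟩⟩

instance : One (CocycleExt f) := ⟨⟨1, 1⟩⟩

instance : Inv (CocycleExt f) :=
  ⟨fun x => ⟨x.base⁻¹, x.fiber⁻¹ * (f.toFun x.base⁻¹ x.base)⁻¹⟩⟩

@[simp] theorem base_mul (x y : CocycleExt f) : (x * y).base = x.base * y.base := rfl
@[simp] theorem fiber_mul (x y : CocycleExt f) :
    (x * y).fiber = x.fiber * y.fiber * f.toFun x.base y.base := rfl
@[simp] theorem base_one : (1 : CocycleExt f).base = 1 := rfl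
@[simp] theorem fiber_one : (1 : CocycleExt f).fiber = 1 := rfl
@[simp] theorem base_inv (x : CocycleExt f) : (x⁻¹).base = x.base⁻¹ := rfl
@[simp] theorem fiber_inv (x : CocycleExt f) :
    (x⁻¹).fiber = x.fiber⁻¹ * (f.toFun x.base⁻¹ x.base)⁻¹ := rfl

instance : CommGroup (CocycleExt f) where
  mul_assoc x y z := by
    ext
    · simp [mul_assoc]
    · simp only [fiber_mul, base_mul]
      have h := f.cocycle x.base y.base z.base
      calc x.fiber * y.fiber * f.toFun x.base y.base * z.fiber * f.toFun (x.base * y.base) z.base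
          = x.fiber * y.fiber * z.fiber
              * (f.toFun (x.base * y.base) z.base * f.toFun x.base y.base) := by
            ac_rfl
        _ = x.fiber * (y.fiber * z.fiber * f.toFun y.base z.base)
              * f.toFun x.base (y.base * z.base) := by
            rw [h]
            ac_rfl
  one_mul x := by ext <;> simp [f.one_left]
  mul_one x := by ext <;> simp [f.one_right]
  inv_mul_cancel x := by
    ext
    · simp
    · simp only [fiber_mul, fiber_inv, base_inv, fiber_one]
      rw [mul_right_comm (x.fiber)⁻¹, inv_mul_cancel, one_mul, inv_mul_cancel]
  mul_comm x y := by
    ext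
    · simp [mul_comm]
    · simp [mul_comm x.fiber, f.symm x.base]

/-- The projection of the extension onto `B`. -/
def proj : CocycleExt f →* B where
  toFun := base
  map_one' := rfl
  map_mul' _ _ := rfl

end CocycleExt

section Deformation

variable {n : ℕ} {R : Type*} [CommRing R] {Z : Type*} [CommGroup Z]

/-- The deformed torus `D_n(R, f, Z)`: the abelian extension of `Z` by `B_n(R)` defined by `f`. -/
abbrev DeformedTorus (f : SymCocycle (B n R) Z) : Type _ := CocycleExt f

/-- The action of `D_n(R, f, Z)` on `UT_n(R)`: an element acts through its image `b` in
`B_n(R)`, by the conjugation `u ↦ b u b⁻¹` in `T_n(R)`. -/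
def torusAction (f : SymCocycle (B n R) Z) : DeformedTorus f →* MulAut (UT n R) :=
  (MulAut.conjNormal (H := UT n R)).comp ((BHom n R).comp (CocycleExt.proj f))

/-- The abelian deformation `T_n(R, f, Z) = UT_n(R) ⋊ D_n(R, f, Z)`; for `Z = Rˣ` this is
`T_n(R, f)`. -/
abbrev DeformedT (f : SymCocycle (B n R) Z) : Type _ :=
  UT n R ⋊[torusAction f] DeformedTorus f

end Deformation

end TriangularDeformation

namespace TriangularDeformation

open scoped FirstOrder Nat
open Filter

/-! ### A family of symmetric cocycles on `ℚ` with values in `ℤ` -/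

/-! The deformations come from uncountably many extensions of `ℚ` by `ℤ`, of which a countable field
can split only countably many. A sequence `ε` of binary digits gives the profinite integer `α = ∑ ε
j * (j * j!)`. Multiplication by `α` is a homomorphism `ℚ → ℚ/ℤ`; `twist ε` lifts it to `ℚ`, and
`twistDefect ε` is the resulting integral cocycle. Take a countable `F ≡ ℚ` in which `ℚ` is a direct
factor of `Fˣ`, with projection `v`, while `c = 2` acquires no new roots (`exists_countable_field`).
Pulling back along `v` on one coordinate and pushing forward along `m ↦ c ^ m` gives `f ε`.

Elementary equivalence: a nonstandard partial sum of `α` serves all standard denominators at once,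
so over an ultrapower `twist ε` is `ℚ`-linear up to integers and the cocycle is a coboundary
(`exists_germ_twistDefect_eq`). Hence `T_n(F, f ε)` and `T_n(F)` have isomorphic ultrapowers
(`GroupElemEquiv.of_twist`), and `T_n(F) ≡ T_n(ℚ)` because `T_n` is interpreted uniformly in the
field (`FieldElemEquiv.groupElemEquiv_T`).

Non-isomorphism: the centre of `T_n(L)` is a retract, so an isomorphism would split `Fˣ` off the
deformed torus (`DeformedT.exists_retraction_of_mulEquiv`) and give `t : ℚ → Fˣ` trivializing the
cocycle. Then `t (1/N) ^ N = t 1 * c ^ α_N`, with `α_N` a partial sum, so `t 1` determines `ε j` for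
`j > 0` (`eq_of_trivialization`). If this happened for every `ε`, there would be only countably many
`ε`. -/

/-- The sum of the numbers `j * j!` over those `j < k` with `ε j`. -/
def factorialSum (ε : ℕ → Bool) (k : ℕ) : ℕ :=
  ∑ j ∈ Finset.range k, if ε j then j * j ! else 0

theorem factorialSum_succ (ε : ℕ → Bool) (k : ℕ) :
    factorialSum ε (k + 1) = factorialSum ε k + if ε k then k * k ! else 0 :=
  Finset.sum_range_succ _ _

/-- Since `j * j! = (j + 1)! - j!`, the full sum telescopes. The bound makes a partial sum
recoverable from its residue modulo `k !`. -/
theorem factorialSum_lt (ε : ℕ → Bool) (k : ℕ) : factorialSum ε k < k ! := by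
  induction k with
  | zero => simp [factorialSum]
  | succ k ih =>
    rw [factorialSum_succ, Nat.factorial_succ, add_mul, one_mul]
    split_ifs <;> omega

/-- Every term with index at least `d` is divisible by `d`, so the partial sums converge
profinitely. -/
theorem factorialSum_modEq (ε : ℕ → Bool) {d k : ℕ} (hd : 0 < d) (h : d ≤ k) :
    factorialSum ε k ≡ factorialSum ε d [MOD d] := by
  induction k, h using Nat.le_induction with
  | base => rfl
  | succ k hk ih =>
    rw [factorialSum_succ]
    split_ifs
    · have : k * k ! ≡ 0 [MOD d] :=
        (Nat.modEq_zero_iff_dvd).2 (Dvd.dvd.mul_left (Nat.dvd_factorial hd hk) k)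
      simpa using ih.add this
    · simpa using ih

/-- A map `ℚ → ℚ` that is additive modulo `ℤ`. -/
def twist (ε : ℕ → Bool) (q : ℚ) : ℚ := q * factorialSum ε q.den

/-- Modulo `ℤ` any partial sum past the denominator may be used, so finitely many rationals can
share one multiplier. -/
theorem mul_factorialSum_eq_twist_add (ε : ℕ → Bool) {q : ℚ} {k : ℕ} (h : q.den ≤ k) :
    ∃ m : ℤ, twist ε q = q * factorialSum ε k + m := by
  obtain ⟨c, hc⟩ := (factorialSum_modEq ε q.den_pos h).dvd
  refine ⟨q.num * c, ?_⟩
  have hc' : (factorialSum ε q.den : ℚ) - factorialSum ε k = q.den * c := by exact_mod_cast hc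
  have hq : q * q.den = q.num := Rat.mul_den_eq_num q
  rw [twist]
  push_cast
  rw [← hq]
  linear_combination q * hc'

theorem twist_zero (ε : ℕ → Bool) : twist ε 0 = 0 := by simp [twist]

/-- The failure of `twist ε` to be additive. -/
def twistDefect (ε : ℕ → Bool) (x y : ℚ) : ℤ := ⌊twist ε x + twist ε y - twist ε (x + y)⌋

/-- The floor loses nothing: with a common multiplier for `x`, `y` and `x + y` the non-integral
parts cancel. -/
theorem coe_twistDefect (ε : ℕ → Bool) (x y : ℚ) :
    (twistDefect ε x y : ℚ) = twist ε x + twist ε y - twist ε (x + y) := by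
  obtain ⟨a, ha⟩ := mul_factorialSum_eq_twist_add ε (q := x)
    (k := max x.den (max y.den (x + y).den)) (by simp)
  obtain ⟨b, hb⟩ := mul_factorialSum_eq_twist_add ε (q := y)
    (k := max x.den (max y.den (x + y).den)) (by simp)
  obtain ⟨c, hc⟩ := mul_factorialSum_eq_twist_add ε (q := x + y)
    (k := max x.den (max y.den (x + y).den)) (by simp)
  have h : twist ε x + twist ε y - twist ε (x + y) = ((a + b - c : ℤ) : ℚ) := by
    push_cast
    linear_combination ha + hb - hc
  rw [twistDefect, h, Int.floor_intCast]

theorem twistDefect_comm (ε : ℕ → Bool) (x y : ℚ) : twistDefect ε x y = twistDefect ε y x := by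
  rw [twistDefect, twistDefect, add_comm x, add_comm (twist ε x)]

theorem twistDefect_zero_left (ε : ℕ → Bool) (x : ℚ) : twistDefect ε 0 x = 0 := by
  simp [twistDefect, twist_zero]

theorem twistDefect_cocycle (ε : ℕ → Bool) (x y z : ℚ) :
    twistDefect ε (x + y) z + twistDefect ε x y = twistDefect ε x (y + z) + twistDefect ε y z := by
  apply Int.cast_injective (α := ℚ)
  push_cast
  simp only [coe_twistDefect, add_assoc]
  ring

/-- The symmetric cocycle on `B` obtained from `twistDefect ε` along `v : B → ℚ` and
`ℤ → A, m ↦ a ^ m`. -/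
@[simps]
def twistCocycle {B A : Type*} [CommGroup B] [CommGroup A] (ε : ℕ → Bool)
    (v : B →* Multiplicative ℚ) (a : A) : SymCocycle B A where
  toFun x y := a ^ twistDefect ε (v x).toAdd (v y).toAdd
  cocycle x y z := by
    simp only [map_mul, toAdd_mul, ← zpow_add, twistDefect_cocycle]
  one_left x := by simp [twistDefect_zero_left]
  one_right x := by simp [twistDefect_comm ε _ 0, twistDefect_zero_left]
  symm x y := by rw [twistDefect_comm]

/-- A trivialization `t` of the cocycle `twistDefect ε`, with values in a group where the order
of divisibility of `a ^ m` is that of `m`, determines `ε` from `t 1`. -/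
theorem eq_of_trivialization {A : Type*} [CommGroup A] {a : A}
    (ha : ∀ (N : ℕ) (M : ℤ), 0 < N → (∃ y : A, y ^ N = a ^ M) → (N : ℤ) ∣ M)
    {ε ε' : ℕ → Bool} {t t' : ℚ → A}
    (ht : ∀ x y, t x * t y = t (x + y) * a ^ twistDefect ε x y)
    (ht' : ∀ x y, t' x * t' y = t' (x + y) * a ^ twistDefect ε' x y)
    (h1 : t 1 = t' 1) {j : ℕ} (hj : 0 < j) : ε j = ε' j := by
  -- powers of the values of a trivialization
  have key : ∀ {ε : ℕ → Bool} {t : ℚ → A},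
      (∀ x y, t x * t y = t (x + y) * a ^ twistDefect ε x y) → ∀ (x : ℚ) (n : ℕ), 0 < n →
      ∃ m : ℤ, (m : ℚ) = n * twist ε x - twist ε (n * x) ∧ t x ^ n = t (n * x) * a ^ m := by
    intro ε t ht x n hn
    induction n, hn using Nat.le_induction with
    | base => exact ⟨0, by simp, by simp⟩
    | succ n hn ih =>
      obtain ⟨m, hm, e⟩ := ih
      refine ⟨m + twistDefect ε (n * x) x, ?_, ?_⟩
      · push_cast
        rw [hm, coe_twistDefect]
        ring_nf
      · rw [pow_succ, e, mul_right_comm, ht, Nat.cast_succ, add_mul, one_mul, mul_assoc, ← zpow_add,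
          add_comm m]
  have twist_one : ∀ ε, twist ε 1 = 0 := by
    intro ε
    simp [twist, factorialSum]
  have sum_eq : ∀ {ε : ℕ → Bool} {t : ℚ → A},
      (∀ x y, t x * t y = t (x + y) * a ^ twistDefect ε x y) → ∀ n : ℕ, 0 < n →
      t (1 / n) ^ n = t 1 * a ^ (factorialSum ε n : ℤ) := by
    intro ε t ht n hn
    obtain ⟨m, hm, e⟩ := key ht (1 / n) n hn
    have hn' : (n : ℚ) ≠ 0 := by positivity
    have hden : (1 / n : ℚ).den = n := by
      simp [hn.ne']
    rw [mul_one_div_cancel hn', twist_one, twist, hden, sub_zero, ← mul_assoc,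
      mul_one_div_cancel hn', one_mul] at hm
    rw [mul_one_div_cancel hn'] at e
    have : m = (factorialSum ε n : ℤ) := by exact_mod_cast hm
    rw [e, this]
  -- As `t 1 = t' 1`, the quotient of the values at `1 / k!` is a `k!`-th root of a power of `c`
  -- whose exponent is the difference of the two sums.
  have eq_fac : ∀ k : ℕ, factorialSum ε (k !) ≡ factorialSum ε' (k !) [MOD k !] := by
    intro k
    rw [Nat.modEq_iff_dvd]
    refine ha _ _ k.factorial_pos ⟨t' (1 / (k ! : ℕ)) * (t (1 / (k ! : ℕ)))⁻¹, ?_⟩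
    rw [mul_pow, inv_pow, sum_eq ht _ k.factorial_pos, sum_eq ht' _ k.factorial_pos, h1, zpow_sub,
      mul_inv, mul_mul_mul_comm, mul_inv_cancel, one_mul]
  have eq_sum : ∀ k, factorialSum ε k = factorialSum ε' k := by
    intro k
    rcases Nat.eq_zero_or_pos k with rfl | hk
    · simp [factorialSum]
    have expand : ∀ ε : ℕ → Bool, factorialSum ε (k !) ≡ factorialSum ε k [MOD k !] := by
      intro ε
      have : ∀ m, k ≤ m → factorialSum ε m ≡ factorialSum ε k [MOD k !] := by
        intro m hm
        induction m, hm using Nat.le_induction with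
        | base => rfl
        | succ m hm ih =>
          rw [factorialSum_succ]
          split_ifs
          · have : m * m ! ≡ 0 [MOD k !] :=
              (Nat.modEq_zero_iff_dvd).2 (Dvd.dvd.mul_left (Nat.factorial_dvd_factorial hm) m)
            simpa using ih.add this
          · simpa using ih
      exact this _ (Nat.self_le_factorial k)
    exact (((expand ε).symm.trans (eq_fac k)).trans (expand ε')).eq_of_lt_of_lt
      (factorialSum_lt ε k) (factorialSum_lt ε' k)
  have h := eq_sum (j + 1)
  rw [factorialSum_succ, factorialSum_succ, eq_sum j, Nat.add_left_cancel_iff] at h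
  have hpos : j * j ! ≠ 0 := by positivity
  cases h₁ : ε j <;> cases h₂ : ε' j <;> simp_all

/-! ### The cocycles become coboundaries in an ultrapower -/

theorem exists_germ_twist_eq (ε : ℕ → Bool) (x : Germ (hyperfilter ℕ : Filter ℕ) ℚ) :
    ∃ c : Germ (hyperfilter ℕ : Filter ℕ) ℚ, ∀ q : ℚ,
      ∃ m : Germ (hyperfilter ℕ : Filter ℕ) ℤ,
        Germ.map (twist ε) (q • x) = q • c + Germ.map (Int.cast : ℤ → ℚ) m := by
  induction x using Germ.inductionOn with | _ X
  -- The index `(X i).den * i` eventually exceeds the denominator of `q * X i` for each fixed `q`,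
  -- so `c` does not depend on `q`.
  refine ⟨((fun i => X i * factorialSum ε ((X i).den * i) : ℕ → ℚ) : Germ _ ℚ), fun q => ?_⟩
  have hev : ∀ᶠ i in (hyperfilter ℕ : Filter ℕ), q.den ≤ i :=
    (Nat.hyperfilter_le_atTop) (eventually_ge_atTop q.den)
  have : ∀ᶠ i in (hyperfilter ℕ : Filter ℕ), ∃ m : ℤ,
      twist ε (q • X i) = q • (X i * factorialSum ε ((X i).den * i)) + m := by
    filter_upwards [hev] with i hi
    have hden : (q * X i).den ≤ (X i).den * i := by
      calc (q * X i).den ≤ q.den * (X i).den :=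
            Nat.le_of_dvd (by positivity) (Rat.mul_den_dvd q (X i))
        _ ≤ (X i).den * i := by rw [mul_comm]; gcongr
    simpa [smul_eq_mul, mul_assoc] using mul_factorialSum_eq_twist_add ε hden
  obtain ⟨m, hm⟩ := this.choice
  refine ⟨((m : ℕ → ℤ) : Germ (hyperfilter ℕ : Filter ℕ) ℤ), ?_⟩
  exact Germ.coe_eq.2 hm

theorem germ_map_intCast_injective {l : Filter ℕ} :
    Function.Injective (Germ.map (Int.cast : ℤ → ℚ) : Germ l ℤ → Germ l ℚ) := by
  intro a b
  induction a, b using Germ.inductionOn₂ with | _ a b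
  intro h
  exact Germ.coe_eq.2 ((Germ.coe_eq.1 h).mono fun i hi => Int.cast_injective hi)

theorem germ_map_intCast_add {l : Filter ℕ} (a b : Germ l ℤ) :
    (Germ.map (Int.cast : ℤ → ℚ) (a + b) : Germ l ℚ) = Germ.map Int.cast a + Germ.map Int.cast b := by
  induction a, b using Germ.inductionOn₂ with | _ a b
  exact congrArg _ (funext fun i => Int.cast_add _ _)

theorem germ_map_intCast_sub {l : Filter ℕ} (a b : Germ l ℤ) :
    (Germ.map (Int.cast : ℤ → ℚ) (a - b) : Germ l ℚ) = Germ.map Int.cast a - Germ.map Int.cast b := by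
  induction a, b using Germ.inductionOn₂ with | _ a b
  exact congrArg _ (funext fun i => Int.cast_sub _ _)

theorem germ_map_twistDefect {l : Filter ℕ} (ε : ℕ → Bool) (x y : Germ l ℚ) :
    Germ.map (Int.cast : ℤ → ℚ) (Germ.map₂ (twistDefect ε) x y) =
      Germ.map (twist ε) x + Germ.map (twist ε) y - Germ.map (twist ε) (x + y) := by
  induction x, y using Germ.inductionOn₂ with | _ x y
  exact congrArg _ (funext fun i => coe_twistDefect ε _ _)

/-- Let `S` be the `ℚ`-linear map that agrees with the twist, modulo integers, on all rational
multiples of basis vectors. Both are additive modulo integers, so they agree everywhere modulo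
integers, and `σ` is their integral difference. -/
theorem exists_germ_twistDefect_eq (ε : ℕ → Bool) :
    ∃ σ : Germ (hyperfilter ℕ : Filter ℕ) ℚ → Germ (hyperfilter ℕ : Filter ℕ) ℤ,
      ∀ x y, Germ.map₂ (twistDefect ε) x y = σ x + σ y - σ (x + y) := by
  let b := Module.Basis.ofVectorSpace ℚ (Germ (hyperfilter ℕ : Filter ℕ) ℚ)
  choose c hc using fun i => exists_germ_twist_eq ε (b i)
  let S := b.constr ℚ c
  have key : ∀ x, ∃ m : Germ (hyperfilter ℕ : Filter ℕ) ℤ,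
      Germ.map (twist ε) x = S x + Germ.map (Int.cast : ℤ → ℚ) m := by
    intro x
    induction b.mem_span x using Submodule.closure_induction with
    | zero =>
      refine ⟨0, ?_⟩
      rw [map_zero, zero_add]
      exact congrArg _ (funext fun i => by simp [twist_zero])
    | add x y _ _ hx hy =>
      obtain ⟨m, hm⟩ := hx
      obtain ⟨m', hm'⟩ := hy
      refine ⟨m + m' - Germ.map₂ (twistDefect ε) x y, ?_⟩
      rw [germ_map_intCast_sub, germ_map_intCast_add, germ_map_twistDefect, map_add, hm, hm']
      abel
    | smul_mem q x hx =>
      obtain ⟨i, rfl⟩ := hx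
      obtain ⟨m, hm⟩ := hc i q
      exact ⟨m, by rw [hm, map_smul, b.constr_basis]⟩
  choose σ hσ using key
  refine ⟨σ, fun x y => germ_map_intCast_injective ?_⟩
  rw [germ_map_twistDefect, germ_map_intCast_sub, germ_map_intCast_add, hσ, hσ, hσ, map_add]
  abel

/-! ### Ultrapowers of groups and fields -/

theorem GroupElemEquiv.of_mulEquiv {G H : Type*} [Group G] [Group H] (e : G ≃* H) :
    GroupElemEquiv G H := by
  let e' : G ≃[groupLanguage] H :=
    { e with
      map_fun' := by
        rintro _ (_ | _ | _) x
        · exact map_mul e _ _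
        · exact map_inv e _
        · exact map_one e
      map_rel' := by rintro _ ⟨⟩ }
  exact e'.toElementaryEmbedding.elementarilyEquivalent

theorem GroupElemEquiv.germ {α : Type*} (U : Ultrafilter α) (G : Type*) [Group G] :
    GroupElemEquiv (Germ (U : Filter α) G) G := by
  let e : (U : Filter α).Product (fun _ => G) ≃[groupLanguage] Germ (U : Filter α) G :=
    { toEquiv := Equiv.refl _
      map_fun' := by
        intro k f x
        obtain ⟨y, rfl⟩ : ∃ y : Fin k → α → G, x = fun i => Quotient.mk _ (y i) :=
          ⟨fun i => (x i).out, funext fun i => (Quotient.out_eq _).symm⟩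
        rcases f with _ | _ | _
        · exact FirstOrder.Language.Ultraproduct.funMap_cast (L := groupLanguage)
            GroupFunc.mul y
        · exact FirstOrder.Language.Ultraproduct.funMap_cast (L := groupLanguage)
            GroupFunc.inv y
        · exact FirstOrder.Language.Ultraproduct.funMap_cast (L := groupLanguage)
            GroupFunc.one y
      map_rel' := by rintro _ ⟨⟩ }
  refine e.toElementaryEmbedding.elementarilyEquivalent.symm.trans ?_
  rw [FirstOrder.Language.elementarilyEquivalent_iff]
  intro s
  rw [FirstOrder.Language.Ultraproduct.sentence_realize]
  simp

theorem FieldElemEquiv.germ {α : Type*} (U : Ultrafilter α) (K : Type*) [Field K] :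
    FieldElemEquiv (Germ (U : Filter α) K) K := by
  unfold FieldElemEquiv
  let _ := FirstOrder.Ring.compatibleRingOfRing K
  let _ := FirstOrder.Ring.compatibleRingOfRing (Germ (U : Filter α) K)
  let e : (U : Filter α).Product (fun _ => K) ≃[FirstOrder.Language.ring] Germ (U : Filter α) K :=
    { toEquiv := Equiv.refl _
      map_fun' := by
        intro k f x
        obtain ⟨y, rfl⟩ : ∃ y : Fin k → α → K, x = fun i => Quotient.mk _ (y i) :=
          ⟨fun i => (x i).out, funext fun i => (Quotient.out_eq _).symm⟩
        rcases f with _ | _ | _ | _ | _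
        · exact FirstOrder.Language.Ultraproduct.funMap_cast FirstOrder.Ring.addFunc y
        · exact FirstOrder.Language.Ultraproduct.funMap_cast FirstOrder.Ring.mulFunc y
        · exact FirstOrder.Language.Ultraproduct.funMap_cast FirstOrder.Ring.negFunc y
        · exact FirstOrder.Language.Ultraproduct.funMap_cast FirstOrder.Ring.zeroFunc y
        · exact FirstOrder.Language.Ultraproduct.funMap_cast FirstOrder.Ring.oneFunc y
      map_rel' := by rintro _ ⟨⟩ }
  refine e.toElementaryEmbedding.elementarilyEquivalent.symm.trans ?_
  rw [FirstOrder.Language.elementarilyEquivalent_iff]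
  intro s
  rw [FirstOrder.Language.Ultraproduct.sentence_realize]
  simp

/-- Two groups whose multiplications differ by the cocycle `twistDefect ε`, with values in a
cyclic central subgroup, are elementarily equivalent. -/
theorem GroupElemEquiv.of_twist {G H : Type*} [Group G] [Group H] (ε : ℕ → Bool) (e : G ≃ H)
    (w : H →* Multiplicative ℚ) {c : H} (hc : ∀ h, c * h = h * c) (hw : w c = 1)
    (he : ∀ x y, e (x * y) =
      e x * e y * c ^ twistDefect ε (w (e x)).toAdd (w (e y)).toAdd) :
    GroupElemEquiv G H := by
  obtain ⟨σ, hσ⟩ := exists_germ_twistDefect_eq ε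
  let l : Filter ℕ := (hyperfilter ℕ : Filter ℕ)
  let W : Germ l H → Germ l ℚ := Germ.map fun h => (w h).toAdd
  let P : Germ l ℤ → Germ l H := Germ.map fun m => c ^ m
  let E : Germ l G → Germ l H := Germ.map e
  let E' : Germ l H → Germ l G := Germ.map e.symm
  have hWmul : ∀ a b, W (a * b) = W a + W b := by
    intro a b
    induction a, b using Germ.inductionOn₂ with | _ a b
    exact congrArg _ (funext fun i => by simp)
  have hWP : ∀ m, W (P m) = 0 := by
    intro m
    induction m using Germ.inductionOn with | _ m
    exact congrArg _ (funext fun i => by simp [hw])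
  have hPadd : ∀ a b, P (a + b) = P a * P b := by
    intro a b
    induction a, b using Germ.inductionOn₂ with | _ a b
    exact congrArg _ (funext fun i => zpow_add c _ _)
  have hPcomm : ∀ a h, P a * h = h * P a := by
    intro a h
    induction a, h using Germ.inductionOn₂ with | _ a h
    exact congrArg _ (funext fun i => ((show Commute c (h i) from hc _).zpow_left _).eq)
  have hP0 : P 0 = 1 := congrArg _ (funext fun i => zpow_zero c)
  have hE : ∀ x y, E (x * y) = E x * E y * P (Germ.map₂ (twistDefect ε) (W (E x)) (W (E y))) := by
    intro x y
    induction x, y using Germ.inductionOn₂ with | _ x y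
    exact congrArg _ (funext fun i => he _ _)
  have hEE' : ∀ y, E (E' y) = y := by
    intro y
    induction y using Germ.inductionOn with | _ y
    exact congrArg _ (funext fun i => e.apply_symm_apply _)
  have hE'E : ∀ x, E' (E x) = x := by
    intro x
    induction x using Germ.inductionOn with | _ x
    exact congrArg _ (funext fun i => e.symm_apply_apply _)
  -- The coboundary `σ` corrects the transported bijection. Central factors `P m` are invisible to
  -- `W`, so the inverse corrects by `-σ` at the same point.
  let Θ : Germ l G ≃* Germ l H :=
    { toFun := fun x => E x * P (σ (W (E x)))
      invFun := fun y => E' (y * P (-σ (W y)))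
      left_inv := fun x => by
        simp only [hWmul, hWP, add_zero]
        rw [mul_assoc, ← hPadd, add_neg_cancel, hP0, mul_one, hE'E]
      right_inv := fun y => by
        simp only [hEE', hWmul, hWP, add_zero]
        rw [mul_assoc, ← hPadd, neg_add_cancel, hP0, mul_one]
      map_mul' := fun x y => by
        have hW : W (E (x * y)) = W (E x) + W (E y) := by rw [hE, hWmul, hWmul, hWP, add_zero]
        rw [hW, hE, hσ, mul_assoc, ← hPadd, sub_add_cancel, hPadd, mul_assoc, mul_assoc,
          ← mul_assoc (P _) (E y), hPcomm _ (E y), ← mul_assoc (E y), mul_assoc] }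
  exact ((GroupElemEquiv.germ (hyperfilter ℕ) G).symm.trans (GroupElemEquiv.of_mulEquiv Θ)).trans
    (GroupElemEquiv.germ (hyperfilter ℕ) H)

/-! ### Diagonal entries, scalar matrices and centres -/

section Matrices

variable {n : ℕ} {R : Type*} [CommRing R]

/-- The `i`-th diagonal entry of an element of `T_n(R)`. -/
@[simps]
def T.diagUnit (i : Fin n) : T n R →* Rˣ where
  toFun g := ⟨(g : GL (Fin n) R) i i, ((g⁻¹ : T n R) : GL (Fin n) R) i i, T.inv_diag g i, by
    rw [mul_comm, T.inv_diag]⟩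
  map_one' := Units.ext (by simp)
  map_mul' g h := Units.ext (T.mul_diag g h i)

theorem T.ext_entries {g h : T n R}
    (e : ∀ i j, (g : GL (Fin n) R) i j = (h : GL (Fin n) R) i j) : g = h :=
  Subtype.ext (Units.ext (Matrix.ext e))

theorem mem_UT_iff {g : T n R} : g ∈ UT n R ↔ ∀ i, T.diagUnit i g = 1 :=
  forall_congr' fun i => by rw [Units.ext_iff]; rfl

theorem diagUnit_diagHom (a : Fin n → Rˣ) (i : Fin n) : T.diagUnit i (diagHom n R a) = a i :=
  Units.ext (by simp [diagHom])

theorem diagUnit_BHom (b : B n R) (i : Fin n) :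
    T.diagUnit i (BHom n R b) = if h : (i : ℕ) < n - 1 then b ⟨i, h⟩ else 1 :=
  diagUnit_diagHom _ i

theorem mul_diagHom_apply (g : T n R) (a : Fin n → Rˣ) (i j : Fin n) :
    ((g * diagHom n R a : T n R) : GL (Fin n) R) i j = (g : GL (Fin n) R) i j * a j := by
  simp [diagHom]

theorem diagHom_mul_apply (g : T n R) (a : Fin n → Rˣ) (i j : Fin n) :
    ((diagHom n R a * g : T n R) : GL (Fin n) R) i j = a i * (g : GL (Fin n) R) i j := by
  simp [diagHom]

variable (n R) in
/-- The scalar matrices. -/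
def scalarHom : Rˣ →* T n R := (diagHom n R).comp (Pi.constMonoidHom (Fin n) Rˣ)

theorem diagUnit_scalarHom (a : Rˣ) (i : Fin n) : T.diagUnit i (scalarHom n R a) = a :=
  diagUnit_diagHom _ i

theorem scalarHom_comm (a : Rˣ) (g : T n R) : scalarHom n R a * g = g * scalarHom n R a :=
  T.ext_entries fun i j => by
    change ((diagHom n R _ * g : T n R) : GL (Fin n) R) i j =
      ((g * diagHom n R _ : T n R) : GL (Fin n) R) i j
    rw [mul_diagHom_apply, diagHom_mul_apply, mul_comm]
    rfl

/-- The elementary matrix `1 + E_{ij}` as an element of `T_n(R)`. -/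
def elementary {i j : Fin n} (h : i < j) : T n R :=
  ⟨⟨Matrix.transvection i j 1, Matrix.transvection i j (-1),
    by simp [Matrix.transvection_mul_transvection_same _ _ h.ne],
    by simp [Matrix.transvection_mul_transvection_same _ _ h.ne]⟩, by
    intro a b hab
    have hab : b < a := hab
    have h1 : (i, j) ≠ (a, b) := by
      rintro ⟨⟩
      exact absurd h hab.asymm
    simp only [Matrix.transvection, Matrix.add_apply, Matrix.one_apply_ne hab.ne', zero_add]
    exact Matrix.single_apply_of_ne _ _ _ _ _ (by simpa using h1)⟩

theorem elementary_mem_UT {i j : Fin n} (h : i < j) : elementary (R := R) h ∈ UT n R := by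
  intro k
  have : ¬ (i = k ∧ j = k) := fun hk => h.ne (hk.1.trans hk.2.symm)
  simp [elementary, Matrix.transvection, Matrix.single_apply_of_ne _ _ _ _ _ this]

/-- A triangular matrix commuting with `UT_n(K)` and `B_n(K)` is scalar. -/
theorem T.eq_scalarHom_of_commute {K : Type*} [Field K] (hK : ∃ a : Kˣ, a ≠ 1) (hn : 2 ≤ n)
    {g : T n K} (hB : ∀ b, g * BHom n K b = BHom n K b * g)
    (hU : ∀ u ∈ UT n K, g * u = u * g) (l : Fin n) (hl : (l : ℕ) = n - 1) :
    g = scalarHom n K (T.diagUnit l g) := by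
  obtain ⟨a, ha⟩ := hK
  refine T.ext_entries fun i j => ?_
  change _ = Matrix.diagonal (fun _ => (g : GL (Fin n) K) l l) i j
  rcases lt_trichotomy i j with hij | rfl | hij
  · rw [Matrix.diagonal_apply_ne _ hij.ne]
    have hi : (i : ℕ) < n - 1 := by omega
    -- The diagonal matrix with `a` in place `i` and `1` elsewhere gives `(a - 1) * g i j = 0`;
    -- since `i < j`, place `i` is not the last and so is available in `B`.
    have h := congrArg (fun m : T n K => (m : GL (Fin n) K) i j)
      (hB (Pi.mulSingle ⟨i, hi⟩ a))
    simp only [BHom, MonoidHom.comp_apply, mul_diagHom_apply, diagHom_mul_apply] at h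
    have h2 : (if h : (j : ℕ) < n - 1 then
        (Pi.mulSingle (⟨i, hi⟩ : Fin (n - 1)) a : Fin (n - 1) → Kˣ) ⟨j, h⟩ else 1) = 1 := by
      split_ifs with hj
      · rw [Pi.mulSingle_eq_of_ne]
        simp only [ne_eq, Fin.mk.injEq]
        omega
      · rfl
    simp only [MonoidHom.coe_mk, OneHom.coe_mk, h2, dif_pos hi, Pi.mulSingle_eq_same,
      Units.val_one, mul_one] at h
    have ha' : (a : K) - 1 ≠ 0 := sub_ne_zero.2 fun e => ha (Units.ext e)
    have : ((a : K) - 1) * (g : GL (Fin n) K) i j = 0 := by linear_combination -h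
    exact (mul_eq_zero.1 this).resolve_left ha'
  · rw [Matrix.diagonal_apply_eq]
    rcases eq_or_ne i l with rfl | hil
    · rfl
    have hlt : i < l := by
      refine lt_of_le_of_ne ?_ hil
      rw [Fin.le_def]
      omega
    -- Commuting with `1 + E_{il}` equates the diagonal entries `i` and `l`.
    have h := congrArg (fun m : T n K => (m : GL (Fin n) K) i l)
      (hU _ (elementary_mem_UT hlt))
    simpa [elementary, Matrix.transvection, Matrix.mul_add, Matrix.add_mul] using h
  · rw [Matrix.diagonal_apply_ne _ hij.ne']
    exact g.2 hij

/-! ### Deformations as twisted forms of `T_n` -/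

variable {f : SymCocycle (B n R) Rˣ}

/-- The bijection `(u, (b, z)) ↦ u b z` from `T_n(R, f)` to `T_n(R)`. -/
def DeformedT.toT (x : DeformedT f) : T n R :=
  x.left * BHom n R x.right.base * scalarHom n R x.right.fiber

theorem DeformedT.toT_mul (x y : DeformedT f) :
    toT (x * y) = toT x * toT y * scalarHom n R (f.toFun x.right.base y.right.base) := by
  have h : (((x * y).left : UT n R) : T n R) =
      x.left * (BHom n R x.right.base * y.left * (BHom n R x.right.base)⁻¹) := rfl
  simp only [toT, h, SemidirectProduct.mul_right, CocycleExt.base_mul, CocycleExt.fiber_mul,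
    map_mul, mul_assoc, inv_mul_cancel_left, scalarHom_comm x.right.fiber]

theorem DeformedT.diagUnit_toT (x : DeformedT f) (i : Fin n) :
    T.diagUnit i (toT x) =
      (if h : (i : ℕ) < n - 1 then x.right.base ⟨i, h⟩ else 1) * x.right.fiber := by
  rw [toT, map_mul, map_mul, mem_UT_iff.1 x.left.2, one_mul, diagUnit_BHom, diagUnit_scalarHom]

/-- The image of `B` is `1` in the last diagonal place, so that entry reads off the fibre, and the
other diagonal entries then give the base. -/
theorem DeformedT.toT_bijective (hn : 2 ≤ n) :
    Function.Bijective (toT : DeformedT f → T n R) := by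
  let l : Fin n := ⟨n - 1, by omega⟩
  have hl : ¬ ((l : ℕ) < n - 1) := lt_irrefl _
  constructor
  · intro x y h
    have hz : x.right.fiber = y.right.fiber := by
      have := congrArg (T.diagUnit l) h
      rwa [diagUnit_toT, diagUnit_toT, dif_neg hl, dif_neg hl, one_mul, one_mul] at this
    have hb : x.right.base = y.right.base := by
      funext i
      have := congrArg (T.diagUnit (⟨i, by omega⟩ : Fin n)) h
      rw [diagUnit_toT, diagUnit_toT, hz] at this
      simpa using this
    have hr : x.right = y.right := CocycleExt.ext hb hz
    refine SemidirectProduct.ext (Subtype.ext ?_) hr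
    rw [toT, toT, hr] at h
    exact mul_right_cancel (mul_right_cancel h)
  · intro g
    let z : Rˣ := T.diagUnit l g
    let b : B n R := fun i => T.diagUnit (⟨i, by omega⟩ : Fin n) g * z⁻¹
    refine ⟨⟨⟨g * (scalarHom n R z)⁻¹ * (BHom n R b)⁻¹, mem_UT_iff.2 fun i => ?_⟩, ⟨b, z⟩⟩, ?_⟩
    · rw [map_mul, map_mul, map_inv, map_inv, diagUnit_scalarHom, diagUnit_BHom]
      split_ifs with hi
      · simp [b]
      · have : i = l := Fin.ext (by simp only [l]; omega)
        rw [this]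
        simp [z]
    · simp [toT]

/-- The deformation `T_n(R, f)` by a twisting cocycle is elementarily equivalent to `T_n(R)`. -/
theorem DeformedT.groupElemEquiv (hn : 2 ≤ n) (ε : ℕ → Bool) (v : Rˣ →* Multiplicative ℚ)
    (i₀ : Fin (n - 1)) (c : Rˣ) :
    GroupElemEquiv
      (DeformedT (twistCocycle ε (v.comp (Pi.evalMonoidHom (fun _ : Fin (n - 1) => Rˣ) i₀)) c))
      (T n R) := by
  let l : Fin n := ⟨n - 1, by omega⟩
  let i : Fin n := ⟨i₀, by omega⟩
  -- The ratio of two diagonal entries kills scalars and recovers the base coordinate `i₀`.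
  let w : T n R →* Multiplicative ℚ := v.comp (T.diagUnit i / T.diagUnit l)
  refine GroupElemEquiv.of_twist ε (Equiv.ofBijective _ (toT_bijective hn)) w
    (c := scalarHom n R c) (scalarHom_comm c) ?_ fun x y => ?_
  · simp [w, diagUnit_scalarHom]
  · have hw : ∀ x : DeformedT
        (twistCocycle ε (v.comp (Pi.evalMonoidHom (fun _ : Fin (n - 1) => Rˣ) i₀)) c),
        w (toT x) = v (x.right.base i₀) := by
      intro x
      simp [w, MonoidHom.div_apply, diagUnit_toT, i, l]
    simp only [Equiv.ofBijective_apply, hw]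
    rw [toT_mul]
    simp

end Matrices

/-! ### Interpretation of `T_n(K)` in `K` -/

section Interpretation

open FirstOrder FirstOrder.Language

universe u

variable {n : ℕ}

/-- The matrix of `g` (at `true`) or of `g⁻¹` (at `false`). -/
def T.mat {K : Type*} [CommRing K] (g : T n K) (s : Bool) : Matrix (Fin n) (Fin n) K :=
  match s with
  | true => (g : GL (Fin n) K)
  | false => ((g⁻¹ : T n K) : GL (Fin n) K)

/-- The entries of `g` and of `g⁻¹`, as one family. -/
def T.coords {K : Type*} [CommRing K] (g : T n K) (p : Bool × Fin n × Fin n) : K :=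
  T.mat g p.1 p.2.1 p.2.2

/-- The entries of a group word in elements of `T_n(K)` are given by integral polynomials. -/
theorem exists_matrix_realize_term {β : Type} (t : groupLanguage.Term β) :
    ∃ M : Bool → Matrix (Fin n) (Fin n) (FreeCommRing (β × Bool × Fin n × Fin n)),
      ∀ (K : Type u) [Field K] (x : β → T n K) (s : Bool),
        (M s).map (FreeCommRing.lift fun p => T.coords (x p.1) p.2) = T.mat (t.realize x) s := by
  induction t with
  | var b =>
    refine ⟨fun s => Matrix.of fun i j => FreeCommRing.of (b, s, i, j), fun K _ x s => ?_⟩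
    ext i j
    simp [T.coords]
  | func F ts ih =>
    choose M hM using ih
    rcases F with _ | _ | _
    · refine ⟨fun s => match s with
        | true => M 0 true * M 1 true
        | false => M 1 false * M 0 false, fun K _ x s => ?_⟩
      cases s
      · have h : T.mat ((Term.func (L := groupLanguage) GroupFunc.mul ts).realize x : T n K) false =
            T.mat ((ts 1).realize x) false * T.mat ((ts 0).realize x) false := by
          change ((((ts 0).realize x * (ts 1).realize x)⁻¹ : T n K) : GL (Fin n) K).val = _
          rw [mul_inv_rev]
          rfl
        rw [h, ← hM, ← hM, Matrix.map_mul]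
      · have h : T.mat ((Term.func (L := groupLanguage) GroupFunc.mul ts).realize x : T n K) true =
            T.mat ((ts 0).realize x) true * T.mat ((ts 1).realize x) true := rfl
        rw [h, ← hM, ← hM, Matrix.map_mul]
    -- With the entries of the inverse among the coordinates, inversion is a swap and needs no
    -- division.
    · refine ⟨fun s => M 0 (!s), fun K _ x s => ?_⟩
      rw [hM]
      cases s
      · change _ = (((((ts 0).realize x)⁻¹)⁻¹ : T n K) : GL (Fin n) K).val
        rw [inv_inv]
        rfl
      · rfl
    · refine ⟨fun _ => 1, fun K _ x s => ?_⟩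
      rw [Matrix.map_one _ (map_zero _) (map_one _)]
      cases s
      · change _ = ((((1 : T n K))⁻¹ : T n K) : GL (Fin n) K).val
        rw [inv_one]
        rfl
      · rfl

/-- The families of entries of elements of `T_n(K)` are defined by a formula. -/
theorem exists_formula_range_coords (n : ℕ) :
    ∃ χ : Language.ring.Formula (Bool × Fin n × Fin n),
      ∀ (K : Type u) [Field K] [Ring.CompatibleRing K] (v : Bool × Fin n × Fin n → K),
        χ.Realize v ↔ ∃ g : T n K, (T.coords g) = v := by
  let M : Bool → Matrix (Fin n) (Fin n) (FreeCommRing (Bool × Fin n × Fin n)) :=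
    fun s => Matrix.of fun i j => FreeCommRing.of (s, i, j)
  let χ₁ : Language.ring.Formula (Bool × Fin n × Fin n) := Formula.iInf fun p : Bool × Fin n × Fin n =>
    (Ring.termOfFreeCommRing ((M p.1 * M (!p.1)) p.2.1 p.2.2)).equal
      (Ring.termOfFreeCommRing ((1 : Matrix (Fin n) (Fin n) _) p.2.1 p.2.2))
  let χ₂ : Language.ring.Formula (Bool × Fin n × Fin n) :=
    Formula.iInf fun p : {p : Fin n × Fin n // p.2 < p.1} =>
    (Ring.termOfFreeCommRing (M true p.1.1 p.1.2)).equal (Ring.termOfFreeCommRing 0)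
  refine ⟨χ₁ ⊓ χ₂, fun K _ _ v => ?_⟩
  let N : Bool → Matrix (Fin n) (Fin n) K := fun s => Matrix.of fun i j => v (s, i, j)
  have hN : ∀ s, (M s).map (FreeCommRing.lift v) = N s := by
    intro s
    ext i j
    simp [M, N]
  have h₁ : χ₁.Realize v ↔ ∀ s, N s * N (!s) = 1 := by
    have : ∀ s, N s * N (!s) = (M s * M (!s)).map (FreeCommRing.lift v) := by
      intro s
      rw [Matrix.map_mul, hN, hN]
    have h1 : (1 : Matrix (Fin n) (Fin n) K) =
        (1 : Matrix (Fin n) (Fin n) (FreeCommRing (Bool × Fin n × Fin n))).map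
          (FreeCommRing.lift v) :=
      (Matrix.map_one _ (map_zero _) (map_one _)).symm
    simp only [χ₁, Formula.realize_iInf, Formula.realize_equal, Ring.realize_termOfFreeCommRing,
      this, Prod.forall]
    rw [h1]
    simp only [← Matrix.ext_iff, Matrix.map_apply]
  have h₂ : χ₂.Realize v ↔ ∀ i j, j < i → N true i j = 0 := by
    simp [χ₂, M, N]
  rw [Formula.realize_inf, h₁, h₂]
  constructor
  · rintro ⟨h, h'⟩
    refine ⟨⟨⟨N true, N false, h true, h false⟩, fun i j hij => h' i j hij⟩, ?_⟩
    ext ⟨s, i, j⟩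
    cases s <;> rfl
  · rintro ⟨g, rfl⟩
    have ht : N true = (g : GL (Fin n) K) := rfl
    have hf : N false = ((g⁻¹ : T n K) : GL (Fin n) K) := rfl
    refine ⟨fun s => ?_, fun i j hij => g.2 hij⟩
    cases s <;> simp only [Bool.not_true, Bool.not_false, ht, hf]
    · simp
    · simp

/-- Every formula about `T_n(K)` translates into a formula about `K`. -/
theorem exists_formula_realize_coords {α : Type} {k : ℕ}
    (φ' : groupLanguage.BoundedFormula α k) :
    ∃ ψ' : Language.ring.Formula ((α ⊕ Fin k) × Bool × Fin n × Fin n),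
      ∀ (K : Type u) [Field K] [Ring.CompatibleRing K] (x : α → T n K) (y : Fin k → T n K),
        ψ'.Realize (fun p => T.coords (Sum.elim x y p.1) p.2) ↔ φ'.Realize x y := by
  induction φ' with
  | falsum => exact ⟨⊥, fun K _ _ x y => Iff.rfl⟩
  | equal t₁ t₂ =>
    obtain ⟨M₁, h₁⟩ := exists_matrix_realize_term.{u} (n := n) t₁
    obtain ⟨M₂, h₂⟩ := exists_matrix_realize_term.{u} (n := n) t₂
    refine ⟨Formula.iInf fun p : Fin n × Fin n =>
      (Ring.termOfFreeCommRing (M₁ true p.1 p.2)).equal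
        (Ring.termOfFreeCommRing (M₂ true p.1 p.2)), fun K _ _ x y => ?_⟩
    have e₁ := h₁ K (Sum.elim x y) true
    have e₂ := h₂ K (Sum.elim x y) true
    simp only [← Matrix.ext_iff, Matrix.map_apply] at e₁ e₂
    simp only [Formula.realize_iInf, Formula.realize_equal, Ring.realize_termOfFreeCommRing,
      e₁, e₂, Prod.forall]
    exact ⟨fun h => T.ext_entries h, fun h i j => by
      rw [show t₁.realize (Sum.elim x y) = t₂.realize (Sum.elim x y) from h]⟩
  | rel R => exact R.elim
  | imp _ _ ih₁ ih₂ =>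
    obtain ⟨ψ₁, h₁⟩ := ih₁
    obtain ⟨ψ₂, h₂⟩ := ih₂
    refine ⟨ψ₁.imp ψ₂, fun K _ _ x y => ?_⟩
    rw [Formula.realize_imp, h₁, h₂]
    rfl
  | @all k θ ih =>
    obtain ⟨ψ₁, h₁⟩ := ih
    obtain ⟨χ, hχ⟩ := exists_formula_range_coords.{u} n
    let r : (α ⊕ Fin (k + 1)) × Bool × Fin n × Fin n →
        ((α ⊕ Fin k) × Bool × Fin n × Fin n) ⊕ (Bool × Fin n × Fin n) := fun p =>
      Sum.elim (fun a => Sum.inl (Sum.inl a, p.2))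
        (Fin.lastCases (Sum.inr p.2) fun i => Sum.inl (Sum.inr i, p.2)) p.1
    -- A quantifier over the group becomes one over coordinate families, relativized to those
    -- satisfying `χ`.
    refine ⟨Formula.iAlls (Bool × Fin n × Fin n) ((χ.relabel Sum.inr).imp (ψ₁.relabel r)),
      fun K _ _ x y => ?_⟩
    have hr : ∀ g : T n K,
        (Sum.elim (fun p => T.coords (Sum.elim x y p.1) p.2) (T.coords g) ∘ r :
          (α ⊕ Fin (k + 1)) × Bool × Fin n × Fin n → K) =
        fun p => T.coords (Sum.elim x (Fin.snoc y g : Fin (k + 1) → T n K) p.1) p.2 := by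
      intro g
      funext ⟨a, p⟩
      rcases a with a | i
      · rfl
      · refine Fin.lastCases ?_ (fun i => ?_) i <;> simp [r]
    simp only [Formula.realize_iAlls, Formula.realize_imp, Formula.realize_relabel,
      BoundedFormula.realize_all]
    constructor
    · intro h g
      rw [← h₁, ← hr]
      exact h (T.coords g) ((hχ K _).2 ⟨g, rfl⟩)
    · intro h v hv
      obtain ⟨g, rfl⟩ := (hχ K v).1 hv
      have := (h₁ K x (Fin.snoc y g)).2 (h g)
      rwa [← hr] at this

/-- Elementarily equivalent fields have elementarily equivalent triangular groups. -/
theorem FieldElemEquiv.groupElemEquiv_T {K L : Type u} [Field K] [Field L]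
    (h : FieldElemEquiv K L) (n : ℕ) : GroupElemEquiv (T n K) (T n L) := by
  let _ := Ring.compatibleRingOfRing K
  let _ := Ring.compatibleRingOfRing L
  refine elementarilyEquivalent_iff.2 fun s => ?_
  obtain ⟨ψ', hψ⟩ := exists_formula_realize_coords.{u} (n := n) s
  let r : (Empty ⊕ Fin 0) × Bool × Fin n × Fin n → Empty := fun p =>
    Sum.elim id Fin.elim0 p.1
  have key : ∀ (M : Type u) [Field M] [Ring.CompatibleRing M],
      M ⊨ (ψ'.relabel r : Language.ring.Sentence) ↔ T n M ⊨ s := by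
    intro M _ _
    rw [Sentence.Realize, Formula.realize_relabel, Sentence.Realize, Formula.Realize,
      Formula.Realize, ← hψ M default default]
    refine iff_of_eq (congrArg ψ'.Realize (funext fun p => ?_))
    exact (r p).elim
  rw [← key K, ← key L]
  exact (elementarilyEquivalent_iff.1 h) _

end Interpretation

/-! ### A countable field elementarily equivalent to `ℚ` -/

section CountableField

open FirstOrder FirstOrder.Language

/-- Downward Löwenheim–Skolem theorem for fields. -/
theorem exists_countable_fieldElemEquiv {K : Type} [Field K] [Infinite K] (s : Set K)
    (hs : s.Countable) :
    ∃ (F : Type) (_ : Field F) (_ : Countable F) (ι : F →+* K),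
      FieldElemEquiv F K ∧ ∀ x ∈ s, ∃ y, ι y = x := by
  let _ := Ring.compatibleRingOfRing K
  obtain ⟨S, hsS, hS⟩ := exists_elementarySubstructure_card_eq Language.ring s Cardinal.aleph0.{0}
    le_rfl (by simpa using hs) (by simp [Cardinal.ofNat_le_aleph0]) (by simp)
  have hcount : Countable S := by
    rw [← Cardinal.mk_le_aleph0_iff]
    simpa using hS.le
  have hmodel : S ⊨ Theory.field := inferInstance
  let fieldS : Field S := Field.fieldOfModelField S
  let compS : Ring.CompatibleRing S := Field.compatibleRingOfModelField S
  let ι : S →+* K :=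
    { toFun := Subtype.val
      map_one' := (S.subtype.map_fun Ring.oneFunc ![]).trans (Ring.CompatibleRing.funMap_one _)
      map_zero' := (S.subtype.map_fun Ring.zeroFunc ![]).trans (Ring.CompatibleRing.funMap_zero _)
      map_add' := fun x y =>
        (S.subtype.map_fun Ring.addFunc ![x, y]).trans (Ring.CompatibleRing.funMap_add _)
      map_mul' := fun x y =>
        (S.subtype.map_fun Ring.mulFunc ![x, y]).trans (Ring.CompatibleRing.funMap_mul _) }
  refine ⟨S, fieldS, hcount, ι, ?_, fun x hx => ⟨⟨x, hsS hx⟩, rfl⟩⟩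
  have h : S ≅[Language.ring] K := S.elementarilyEquivalent
  -- The structure induced by the field operations and the inherited one are distinct terms; the
  -- identity is an isomorphism between them.
  let e : @FirstOrder.Language.Equiv Language.ring S S
      (Ring.compatibleRingOfRing S).toStructure compS.toStructure :=
    @FirstOrder.Language.Equiv.mk _ _ _ (Ring.compatibleRingOfRing S).toStructure compS.toStructure
      (_root_.Equiv.refl S)
      (by
        intro k f x
        rcases f with _ | _ | _ | _ | _
        · exact (compS.funMap_add x).symm
        · exact (compS.funMap_mul x).symm
        · exact (compS.funMap_neg x).symm
        · exact (compS.funMap_zero x).symm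
        · exact (compS.funMap_one x).symm)
      (by rintro _ ⟨⟩)
  have h' := @ElementaryEmbedding.elementarilyEquivalent _ _ _ (Ring.compatibleRingOfRing S).toStructure
    compS.toStructure
    (@FirstOrder.Language.Equiv.toElementaryEmbedding _ _ _ (Ring.compatibleRingOfRing S).toStructure
      compS.toStructure e)
  exact Eq.trans h' h

end CountableField

/-- A sequence with `(k + 1) • u (k + 1) = u k` extends to a homomorphism from `ℚ`. -/
theorem exists_addMonoidHom_rat {A : Type*} [AddCommGroup A] (u : ℕ → A)
    (hu : ∀ k, (k + 1) • u (k + 1) = u k) :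
    ∃ j : ℚ →+ A, ∀ (m : ℤ) (k : ℕ), j (m / (k ! : ℕ)) = m • u k := by
  have up : ∀ {k K : ℕ}, k ≤ K → ∃ c : ℕ, K ! = c * k ! ∧ u k = c • u K := by
    intro k K h
    induction K, h using Nat.le_induction with
    | base => exact ⟨1, by simp, by simp⟩
    | succ K h ih =>
      obtain ⟨c, hc, e⟩ := ih
      refine ⟨c * (K + 1), ?_, ?_⟩
      · rw [Nat.factorial_succ, hc]
        ring
      · rw [e, mul_smul, hu]
  have scale : ∀ (m : ℤ) {k K : ℕ}, k ≤ K →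
      ∃ m' : ℤ, (m / (k ! : ℕ) : ℚ) = m' / (K ! : ℕ) ∧ m • u k = m' • u K := by
    intro m k K h
    obtain ⟨c, hc, e⟩ := up h
    have hk : ((k ! : ℕ) : ℚ) ≠ 0 := by positivity
    have hK : ((K ! : ℕ) : ℚ) ≠ 0 := by positivity
    refine ⟨m * c, ?_, ?_⟩
    · rw [div_eq_div_iff hk hK, hc]
      push_cast
      ring
    · rw [e, mul_smul, natCast_zsmul]
  have wd : ∀ (m m' : ℤ) (k k' : ℕ), (m / (k ! : ℕ) : ℚ) = m' / (k' ! : ℕ) →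
      m • u k = m' • u k' := by
    intro m m' k k' h
    obtain ⟨a, ha, e⟩ := scale m (le_max_left k k')
    obtain ⟨b, hb, e'⟩ := scale m' (le_max_right k k')
    have hK : (((max k k') ! : ℕ) : ℚ) ≠ 0 := by positivity
    rw [ha, hb, div_left_inj' hK] at h
    rw [e, e', Int.cast_injective h]
  have rep : ∀ q : ℚ, ∃ (m : ℤ) (k : ℕ), q = m / (k ! : ℕ) := by
    intro q
    obtain ⟨c, hc⟩ := Nat.dvd_factorial q.den_pos le_rfl
    have hd : (q.den : ℚ) ≠ 0 := by exact_mod_cast q.den_ne_zero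
    have hc0 : (c : ℚ) ≠ 0 := by
      rintro h
      have : c = 0 := by exact_mod_cast h
      exact Nat.factorial_ne_zero q.den (by rw [hc, this, mul_zero])
    refine ⟨q.num * c, q.den, ?_⟩
    rw [hc]
    push_cast
    rw [mul_div_mul_right _ _ hc0, Rat.num_div_den]
  choose M k hMk using rep
  have val : ∀ (m : ℤ) (l : ℕ), M (m / (l ! : ℕ)) • u (k (m / (l ! : ℕ))) = m • u l :=
    fun m l => wd _ _ _ _ (hMk _).symm
  refine ⟨AddMonoidHom.mk' (fun q => M q • u (k q)) fun x y => ?_, val⟩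
  obtain ⟨a, ha, e⟩ := scale (M x) (le_max_left (k x) (k y))
  obtain ⟨b, hb, e'⟩ := scale (M y) (le_max_right (k x) (k y))
  have hxy : x + y = ((a + b : ℤ) : ℚ) / ((max (k x) (k y)) ! : ℕ) := by
    conv_lhs => rw [hMk x, hMk y, ha, hb]
    push_cast
    rw [add_div]
  rw [e, e', ← add_smul, hxy, val]

/-- Compare 2-adic valuations. -/
theorem dvd_of_pow_eq_two_zpow {q : ℚ} {N : ℕ} {M : ℤ} (h : q ^ N = 2 ^ M) : (N : ℤ) ∣ M := by
  have hv := congrArg (padicValRat 2) h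
  rw [padicValRat.pow, padicValRat.zpow] at hv
  have h2 : padicValRat 2 (2 : ℚ) = 1 := by simpa using padicValRat.self (p := 2) one_lt_two
  rw [h2, mul_one] at hv
  exact ⟨_, hv.symm⟩

/-- There is a countable field `F ≡ ℚ` such that `ℚ` is a direct factor of `Fˣ`, and in which the
powers of `2` are divisible only as in `ℚ`. -/
theorem exists_countable_field :
    ∃ (F : Type) (_ : Field F) (_ : Countable F) (c : Fˣ) (j : Multiplicative ℚ →* Fˣ)
      (v : Fˣ →* Multiplicative ℚ), FieldElemEquiv F ℚ ∧ (∀ x, v (j x) = x) ∧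
      ∀ (N : ℕ) (M : ℤ), 0 < N → (∃ y : Fˣ, y ^ N = c ^ M) → (N : ℤ) ∣ M := by
  let l : Filter ℕ := (hyperfilter ℕ : Filter ℕ)
  -- For a nonstandard `ω`, these are the elements `2 ^ (ω! / k!)`: a compatible system of roots,
  -- which generates a copy of `ℚ`.
  let h : ℕ → ℕ → ℚ := fun k i => 2 ^ (i ! / k !)
  have : Infinite (Germ (hyperfilter ℕ : Filter ℕ) ℚ) :=
    Infinite.of_injective (fun q : ℚ => ((fun _ => q : ℕ → ℚ) : Germ l ℚ)) fun a b hab =>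
      Germ.const_inj.1 hab
  obtain ⟨F, _, hF, ι, hequiv, hι⟩ := exists_countable_fieldElemEquiv
    (Set.range fun k => ((h k : ℕ → ℚ) : Germ l ℚ)) (Set.countable_range _)
  choose x hx using fun k => hι _ (Set.mem_range_self k)
  have hx0 : ∀ k, x k ≠ 0 := by
    intro k hk
    have h0 := hx k
    rw [hk, map_zero] at h0
    obtain ⟨i, hi⟩ := (Germ.coe_eq.1 h0 : (0 : ℕ → ℚ) =ᶠ[l] h k).exists
    exact (pow_ne_zero _ two_ne_zero) hi.symm
  have hxpow : ∀ k, x (k + 1) ^ (k + 1) = x k := by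
    intro k
    apply ι.injective
    rw [map_pow, hx, hx]
    refine Germ.coe_eq.2 ?_
    have hev : ∀ᶠ i in l, k + 1 ≤ i := Nat.hyperfilter_le_atTop (eventually_ge_atTop (k + 1))
    filter_upwards [hev] with i hi
    change ((2 : ℚ) ^ (i ! / (k + 1)!)) ^ (k + 1) = 2 ^ (i ! / k !)
    obtain ⟨d, hd⟩ := Nat.factorial_dvd_factorial hi
    rw [← pow_mul, hd, Nat.mul_div_cancel_left _ (Nat.factorial_pos _), Nat.factorial_succ]
    congr 1
    rw [mul_comm (k + 1), mul_assoc, Nat.mul_div_cancel_left _ (Nat.factorial_pos _), mul_comm]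
  let u : ℕ → Additive Fˣ := fun k => Additive.ofMul (Units.mk0 (x k) (hx0 k))
  have hu : ∀ k, (k + 1) • u (k + 1) = u k := fun k =>
    congrArg Additive.ofMul (Units.ext (hxpow k))
  obtain ⟨j, hj⟩ := exists_addMonoidHom_rat u hu
  have hu0 : ∀ m : ℤ, m • u 0 = 0 → m = 0 := by
    intro m hm
    have h1 : (x 0) ^ m = 1 := by
      have := congrArg (fun a : Additive Fˣ => (a.toMul : F)) hm
      simpa [u] using this
    have h2 : (((h 0 : ℕ → ℚ) : Germ l ℚ)) ^ m = 1 := by rw [← hx, ← map_zpow₀, h1, map_one]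
    have h3 : (fun i => (h 0 i) ^ m) =ᶠ[l] 1 := Germ.coe_eq.1 h2
    obtain ⟨i, hi⟩ := h3.exists
    have hi : ((2 : ℚ) ^ (i ! / 0 !)) ^ m = 1 := hi
    rw [Nat.factorial_zero, Nat.div_one, ← zpow_natCast, ← zpow_mul,
      zpow_eq_one_iff_right₀ (by norm_num) (by norm_num)] at hi
    exact (mul_eq_zero.1 hi).resolve_left (by exact_mod_cast Nat.factorial_ne_zero i)
  have hinj : Function.Injective j := by
    rw [injective_iff_map_eq_zero]
    intro q hq
    have hq' : (q.den : ℤ) • j q = 0 := by rw [hq, smul_zero]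
    have : q.num • u 0 = 0 := by
      rw [← hj, Nat.factorial_zero, Nat.cast_one, div_one, ← Rat.mul_den_eq_num q, mul_comm,
        ← hq', ← map_zsmul]
      congr 1
    exact Rat.num_eq_zero.1 (hu0 _ this)
  -- `ℚ` is divisible, hence injective, so its embedding in `Fˣ` splits.
  obtain ⟨v, hv⟩ := (Module.Baer.of_divisible ℚ).extension_property_addMonoidHom j hinj
    (AddMonoidHom.id ℚ)
  have two : (2 : F) ≠ 0 := by
    intro h0
    have := congrArg ι h0
    rw [map_zero, map_ofNat] at this
    exact two_ne_zero this
  refine ⟨F, inferInstance, hF, Units.mk0 2 two, AddMonoidHom.toMultiplicativeLeft j,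
    AddMonoidHom.toMultiplicativeRight v, Eq.trans hequiv (FieldElemEquiv.germ _ ℚ),
    fun y => ?_, ?_⟩
  · exact congrArg Multiplicative.ofAdd (DFunLike.congr_fun hv y.toAdd)
  · rintro N M - ⟨y, hy⟩
    have h1 : ι y ^ N = 2 ^ M := by
      have := congrArg (fun z : Fˣ => ι (z : F)) hy
      simpa [map_ofNat ι 2] using this
    revert h1
    generalize ι y = z
    induction z using Germ.inductionOn with | _ z
    intro h1
    have h2 : (fun i => z i ^ N) =ᶠ[l] fun _ => 2 ^ M := Germ.coe_eq.1 h1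
    obtain ⟨i, hi⟩ := h2.exists
    exact dvd_of_pow_eq_two_zpow hi

/-! ### Deformations isomorphic to a triangular group split -/

section Splitting

variable {n : ℕ} {K : Type*} [Field K] (f : SymCocycle (B n K) Kˣ)

/-- The embedding `z ↦ (1, z)` of `Kˣ` in the deformed torus. -/
def CocycleExt.fiberHom : Kˣ →* CocycleExt f where
  toFun z := ⟨1, z⟩
  map_one' := rfl
  map_mul' z z' := CocycleExt.ext (mul_one _).symm (by simp [f.one_left])

/-- The embedding of `Kˣ` in `T_n(K, f)` as its centre. -/
def DeformedT.centerHom : Kˣ →* DeformedT f :=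
  SemidirectProduct.inr.comp (CocycleExt.fiberHom f)

variable {f}

theorem DeformedT.toT_centerHom (z : Kˣ) : toT (centerHom f z) = scalarHom n K z := by
  have h : toT (centerHom f z) = 1 * BHom n K 1 * scalarHom n K z := rfl
  rw [h, map_one, mul_one, one_mul]

theorem DeformedT.centerHom_injective : Function.Injective (centerHom f) := fun _ _ h =>
  congrArg (fun x : DeformedT f => x.right.fiber) h

theorem DeformedT.centerHom_comm (hn : 2 ≤ n) (z : Kˣ) (x : DeformedT f) :
    centerHom f z * x = x * centerHom f z := by
  apply (toT_bijective hn).injective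
  rw [toT_mul, toT_mul, toT_centerHom, scalarHom_comm, f.symm]

/-- By symmetry of `f`, the factors by which `toT` fails to be multiplicative cancel from `x * y = y
* x`, so `toT x` is central and hence scalar. -/
theorem DeformedT.exists_eq_centerHom (hn : 2 ≤ n) (hK : ∃ a : Kˣ, a ≠ 1) {x : DeformedT f}
    (hx : ∀ y, x * y = y * x) : ∃ z, x = centerHom f z := by
  have hcomm : ∀ g, toT x * g = g * toT x := by
    intro g
    obtain ⟨y, rfl⟩ := (toT_bijective (f := f) hn).surjective g
    have := congrArg toT (hx y)
    rw [toT_mul, toT_mul, f.symm] at this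
    exact mul_right_cancel this
  refine ⟨T.diagUnit ⟨n - 1, by omega⟩ (toT x), (toT_bijective hn).injective ?_⟩
  rw [toT_centerHom]
  exact T.eq_scalarHom_of_commute hK hn (fun _ => hcomm _) (fun _ _ => hcomm _) _ rfl

/-- If `T_n(K, f)` is isomorphic to some `T_n(L)`, then the deformed torus splits. -/
theorem DeformedT.exists_retraction_of_mulEquiv [Infinite Kˣ] (hn : 2 ≤ n) {L : Type*} [Field L]
    (e : DeformedT f ≃* T n L) :
    ∃ ρ : CocycleExt f →* Kˣ, ∀ z, ρ (CocycleExt.fiberHom f z) = z := by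
  have hL : ∃ a : Lˣ, a ≠ 1 := by
    -- If `Lˣ` were trivial, `T_n(L)` would be finite, yet the infinite group `Kˣ` embeds in it.
    by_contra! hL
    have : Subsingleton Lˣ := ⟨fun a b => (hL a).trans (hL b).symm⟩
    have : Finite L := by
      refine Set.finite_univ_iff.1 ((Set.toFinite {0, 1}).subset fun a _ => ?_)
      by_cases ha : a = 0
      · exact Or.inl ha
      · exact Or.inr (congrArg Units.val (hL (Units.mk0 a ha)))
    have : Finite (Matrix (Fin n) (Fin n) L) := inferInstanceAs (Finite (Fin n → Fin n → L))
    have : Finite (DeformedT f) := Finite.of_equiv _ e.symm.toEquiv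
    exact not_finite_iff_infinite.2 ‹Infinite Kˣ› (Finite.of_injective _ (centerHom_injective (f := f)))
  have hK : ∃ a : Kˣ, a ≠ 1 := exists_ne 1
  let l : Fin n := ⟨n - 1, by omega⟩
  -- Replacing a matrix over `L` by the scalar matrix of its last diagonal entry is a homomorphism
  -- fixing the centre; `θ` is its transport through `e`.
  let θ : CocycleExt f →* DeformedT f :=
    (e.symm : T n L →* DeformedT f).comp ((scalarHom n L).comp ((T.diagUnit l).comp
      ((e : DeformedT f →* T n L).comp SemidirectProduct.inr)))
  have hθ : ∀ d, ∃ z, θ d = centerHom f z := by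
    intro d
    refine exists_eq_centerHom hn hK fun y => e.injective ?_
    rw [map_mul, map_mul]
    have : e (θ d) = scalarHom n L (T.diagUnit l (e (SemidirectProduct.inr d))) :=
      e.apply_symm_apply _
    rw [this, scalarHom_comm]
  choose r hr using hθ
  refine ⟨MonoidHom.mk' r fun a b => centerHom_injective (f := f) ?_, fun z =>
    centerHom_injective (f := f) ?_⟩
  · rw [map_mul, ← hr, ← hr, ← hr, map_mul]
  · have hz : e (centerHom f z) = scalarHom n L (T.diagUnit l (e (centerHom f z))) := by
      have hcomm : ∀ g, e (centerHom f z) * g = g * e (centerHom f z) := by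
        intro g
        obtain ⟨y, rfl⟩ := e.surjective g
        rw [← map_mul, centerHom_comm hn, map_mul]
      exact T.eq_scalarHom_of_commute hL hn (fun _ => hcomm _) (fun _ _ => hcomm _) l rfl
    refine (hr _).symm.trans ?_
    exact (congrArg e.symm hz.symm).trans (e.symm_apply_apply _)

/-- A retraction onto the fibre trivializes the twisting cocycle. -/
theorem exists_trivialization_of_retraction {ε : ℕ → Bool} {v : Kˣ →* Multiplicative ℚ}
    {j : Multiplicative ℚ →* Kˣ} (hj : ∀ x, v (j x) = x) {i₀ : Fin (n - 1)} {c : Kˣ}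
    {ρ : CocycleExt
      (twistCocycle ε (v.comp (Pi.evalMonoidHom (fun _ : Fin (n - 1) => Kˣ) i₀)) c) →* Kˣ}
    (hρ : ∀ z, ρ (CocycleExt.fiberHom _ z) = z) :
    ∃ t : ℚ → Kˣ, ∀ x y, t x * t y = t (x + y) * c ^ twistDefect ε x y := by
  -- Over the image of `j` in coordinate `i₀` the cocycle is `c ^ twistDefect ε`, because `v`
  -- inverts `j`.
  let b : ℚ → B n K := fun x => Pi.mulSingle i₀ (j (Multiplicative.ofAdd x))
  have hb : ∀ x y, b (x + y) = b x * b y := fun x y => by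
    simp only [b, ofAdd_add, map_mul, Pi.mulSingle_mul]
  refine ⟨fun x => ρ ⟨b x, 1⟩, fun x y => ?_⟩
  dsimp only
  rw [← hρ (c ^ twistDefect ε x y), ← map_mul, ← map_mul]
  congr 1
  refine CocycleExt.ext ?_ ?_
  · simp [CocycleExt.fiberHom, hb]
  · simp [CocycleExt.fiberHom, b, hj, twistDefect_comm ε _ 0, twistDefect_zero_left]

end Splitting

end TriangularDeformation

/-! ### Counting the deformations that split -/

open TriangularDeformation

theorem mainTheorem7 (n : ℕ) (hn : 3 ≤ n) :
    ∃ (F : Type) (_ : Field F)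
      (f : TriangularDeformation.SymCocycle (TriangularDeformation.B n F) Fˣ),
      TriangularDeformation.FieldElemEquiv F ℚ ∧
      TriangularDeformation.GroupElemEquiv
        (TriangularDeformation.DeformedT f) (TriangularDeformation.T n ℚ) ∧
      ∀ (L : Type*) [Field L],
        IsEmpty (TriangularDeformation.DeformedT f ≃* TriangularDeformation.T n L) := by
  obtain ⟨F, _, _, c, j, v, hF, hv, hc⟩ := exists_countable_field
  have : Infinite Fˣ := Infinite.of_injective j (Function.LeftInverse.injective hv)
  let i₀ : Fin (n - 1) := ⟨0, by omega⟩
  let f := fun ε =>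
    twistCocycle ε (v.comp (Pi.evalMonoidHom (fun _ : Fin (n - 1) => Fˣ) i₀)) c
  suffices h : ∃ ε, ∀ (L : Type _) [Field L], IsEmpty (DeformedT (f ε) ≃* T n L) by
    obtain ⟨ε, h⟩ := h
    exact ⟨F, inferInstance, f ε, hF,
      Eq.trans (DeformedT.groupElemEquiv (by omega) ε v i₀ c) (hF.groupElemEquiv_T n), h⟩
  by_contra! h
  have key : ∀ ε, ∃ t : ℚ → Fˣ, ∀ x y, t x * t y = t (x + y) * c ^ twistDefect ε x y := by
    intro ε
    obtain ⟨L, _, ⟨e⟩⟩ := h ε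
    obtain ⟨ρ, hρ⟩ := DeformedT.exists_retraction_of_mulEquiv (by omega) e
    exact exists_trivialization_of_retraction hv hρ
  choose t ht using key
  -- The digit `ε 0` has weight `0 * 0! = 0`, so it is invisible to the cocycle and is recorded
  -- separately.
  have hinj : Function.Injective fun ε : ℕ → Bool => (t ε 1, ε 0) := by
    intro ε ε' he
    obtain ⟨h1, h0⟩ := Prod.mk.inj he
    funext k
    rcases Nat.eq_zero_or_pos k with rfl | hk
    · exact h0
    · exact eq_of_trivialization hc (ht ε) (ht ε') h1 hk
  have : Countable Fˣ := Units.val_injective.countable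
  have : Countable (ℕ → Bool) := hinj.countable
  have hle := Cardinal.mk_le_aleph0 (α := ℕ → Bool)
  rw [Cardinal.mk_arrow, Cardinal.mk_bool, Cardinal.lift_ofNat, Cardinal.mk_nat,
    Cardinal.lift_aleph0] at hle
  exact hle.not_gt (Cardinal.cantor _)
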